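/- Let the Euler polynomials $E_k(x)$, $k\ge 0$, be defined by the generating function $$\frac{2e^{xt}}{e^t+1}=\sum_{k=0}^\infty E_k(x)\frac{t^k}{k!},$$ and for a sequence $(c_k)_{k\ge 0}$ let $H_n(c_k)=\det_{0\le i,j\le n}\bigl(c_{i+j}\bigr)$ denote its Hankel determinant of order $n+1$. Then for all integers $n\ge 1$, $$H_n\!\left(\frac{E_k(1)}{k!}\right)=\frac{(2n+2)!}{(n+1)!}\cdot H_n\!\left(\frac{E_{k+1}(1)}{(k+1)!}\right).$$ -/

import Mathlib

open scoped Nat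

/-- The generating function `2 e^{xt} / (e^t + 1)` of the Euler polynomials, as a formal power series
in `t` whose coefficients are polynomials in `x` over `ℚ`. -/
noncomputable def eulerGenFun : PowerSeries (Polynomial ℚ) :=
  2 * PowerSeries.rescale (Polynomial.X : Polynomial ℚ) (PowerSeries.exp (Polynomial ℚ)) *
    PowerSeries.map Polynomial.C ((PowerSeries.exp ℚ + 1)⁻¹)

/-- The Euler polynomial `E_n(x)`, determined by `2 e^{xt} / (e^t + 1) = ∑ E_n(x) t^n / n!`. -/
noncomputable def eulerPolynomial (n : ℕ) : Polynomial ℚ :=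
  (n ! : ℚ) • PowerSeries.coeff n eulerGenFun

/-- The Hankel determinant `H_n(c) = det (c_{i+j})`, `0 ≤ i, j ≤ n`, a determinant of order `n + 1`. -/
def hankelDet {R : Type*} [CommRing R] (n : ℕ) (c : ℕ → R) : R :=
  Matrix.det (Matrix.of fun i j : Fin (n + 1) => c ((i : ℕ) + (j : ℕ)))

/-- The series `e^t + 1` has constant term `2 ≠ 0`, so the inverse in `eulerGenFun` is a true inverse. -/
theorem eulerGenFun_mul :
    eulerGenFun * (PowerSeries.exp (Polynomial ℚ) + 1) =
      2 * PowerSeries.rescale (Polynomial.X : Polynomial ℚ) (PowerSeries.exp (Polynomial ℚ)) := by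
  have h : (PowerSeries.exp ℚ + 1)⁻¹ * (PowerSeries.exp ℚ + 1) = 1 := by
    apply PowerSeries.inv_mul_cancel
    simp
  have h2 : PowerSeries.exp (Polynomial ℚ) + 1 =
      PowerSeries.map Polynomial.C (PowerSeries.exp ℚ + 1) := by
    rw [map_add, map_one, PowerSeries.map_exp]
  rw [eulerGenFun, h2, mul_assoc, ← map_mul, h, map_one, mul_one]

/-! The numbers `c k = E_k(1)/k!` have generating function `f = 2e^t/(e^t+1)`. Let `P/D` be the
`[n/n+1]` Padé approximant of `exp`, so `D e^t - P = O(t^(2n+2))`. With `Q = (P+D)/2`, `Q f - P = (D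
e^t - P)/(e^t+1)` has the same order. Since `deg P ≤ n`, the coefficients of `Q f` in degrees `n+1,
..., 2n+1` vanish (`coeff_eulerPadeDen_mul`): a recurrence of order `n+1` for `c`. By
`hankelDet_shift` the ratio of the determinants is, up to sign, the top coefficient of `Q`. -/

open Finset in
/-- The alternating binomial sum which expresses the `m`-th difference of `x ↦ x.choose r`. -/
theorem sum_alternating_choose_mul_choose (m N r : ℕ) :
    ∑ j ∈ range (m + 1), (-1 : ℚ) ^ j * (m.choose j : ℚ) * ((N + m - j).choose r : ℚ) =
      if m ≤ r then (N.choose (r - m) : ℚ) else 0 := by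
  -- Expand `X = -1 + (1 + X)`, then compare coefficients of `X^r`.
  have h : (Polynomial.X : Polynomial ℚ) ^ m * (1 + Polynomial.X) ^ N =
      ∑ j ∈ range (m + 1), Polynomial.C ((-1 : ℚ) ^ j * (m.choose j : ℚ)) *
        (1 + Polynomial.X) ^ (N + m - j) := by
    have hX : (Polynomial.X : Polynomial ℚ) ^ m = (-1 + (1 + Polynomial.X)) ^ m := by
      rw [neg_add_cancel_left]
    rw [hX, add_pow, sum_mul]
    refine sum_congr rfl fun j hj => ?_
    have hj' : j ≤ m := Nat.lt_succ_iff.mp (mem_range.mp hj)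
    rw [show N + m - j = (m - j) + N by omega, pow_add]
    simp only [map_mul, map_pow, map_neg, map_one, map_natCast]
    ring
  have h2 := congrArg (fun p => Polynomial.coeff p r) h
  simp only [Polynomial.finsetSum_coeff, Polynomial.coeff_C_mul, Polynomial.coeff_X_pow_mul',
    Polynomial.coeff_one_add_X_pow] at h2
  exact h2.symm

/-- The coefficients of the numerator of the `[n / n + 1]` Padé approximant of `exp`. -/
def expPadeNum (n j : ℕ) : ℚ :=
  (n.choose j : ℚ) * ((2 * n + 1 - j)! : ℚ) / ((2 * n + 1)! : ℚ)

/-- The coefficients of the denominator of the `[n / n + 1]` Padé approximant of `exp`. -/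
def expPadeDen (n j : ℕ) : ℚ :=
  (-1) ^ j * ((n + 1).choose j : ℚ) * ((2 * n + 1 - j)! : ℚ) / ((2 * n + 1)! : ℚ)

/-- The factorial quotients become binomials, so the coefficient is an `(n+1)`-st difference of `x ↦
x.choose (2n+1-s)`. -/
theorem coeff_mk_expPadeDen_mul_exp (n s : ℕ) (hs : s ≤ 2 * n + 1) :
    PowerSeries.coeff s (PowerSeries.mk (expPadeDen n) * PowerSeries.exp ℚ) = expPadeNum n s := by
  have key := sum_alternating_choose_mul_choose (n + 1) n (2 * n + 1 - s)
  have hterm : ∀ j ≤ s, expPadeDen n j * (1 / ((s - j)! : ℚ)) =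
      (-1 : ℚ) ^ j * ((n + 1).choose j : ℚ) *
        ((n + (n + 1) - j).choose (2 * n + 1 - s) : ℚ) *
        (((2 * n + 1 - s)! : ℚ) / ((2 * n + 1)! : ℚ)) := by
    intro j hj
    have hc := Nat.choose_mul_factorial_mul_factorial
      (show 2 * n + 1 - s ≤ n + (n + 1) - j by omega)
    rw [show n + (n + 1) - j - (2 * n + 1 - s) = s - j by omega,
      show (n + (n + 1) - j)! = (2 * n + 1 - j)! by congr 1; omega] at hc
    rw [expPadeDen, ← hc]
    have : ((s - j)! : ℚ) ≠ 0 := by positivity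
    push_cast
    field_simp
  have hterm0 : ∀ j, s < j → ((n + (n + 1) - j).choose (2 * n + 1 - s) : ℚ) *
      ((n + 1).choose j : ℚ) = 0 := by
    intro j hj
    rcases Nat.lt_or_ge (n + 1) j with h | h
    · rw [Nat.choose_eq_zero_of_lt h]; simp
    · rw [Nat.choose_eq_zero_of_lt (show n + (n + 1) - j < 2 * n + 1 - s by omega)]; simp
  have hsum : ∑ j ∈ Finset.range (s + 1), (-1 : ℚ) ^ j * ((n + 1).choose j : ℚ) *
        ((n + (n + 1) - j).choose (2 * n + 1 - s) : ℚ) =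
      ∑ j ∈ Finset.range (n + 1 + 1), (-1 : ℚ) ^ j * ((n + 1).choose j : ℚ) *
        ((n + (n + 1) - j).choose (2 * n + 1 - s) : ℚ) := by
    rcases le_total (s + 1) (n + 1 + 1) with h | h
    · refine Finset.sum_subset (Finset.range_mono h) fun j _ hj => ?_
      rw [mul_assoc, mul_comm (Nat.cast _), hterm0 j (by simpa using hj), mul_zero]
    · refine (Finset.sum_subset (Finset.range_mono h) fun j _ hj => ?_).symm
      rw [Nat.choose_eq_zero_of_lt (show n + 1 < j by simp at hj; omega)]
      simp
  rw [PowerSeries.coeff_mul, Finset.Nat.sum_antidiagonal_eq_sum_range_succ_mk]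
  simp only [PowerSeries.coeff_mk, PowerSeries.coeff_exp, Algebra.algebraMap_self, RingHom.id_apply]
  rw [Finset.sum_congr rfl fun j hj => hterm j (Nat.lt_succ_iff.mp (Finset.mem_range.mp hj)),
    ← Finset.sum_mul, hsum, key, expPadeNum]
  split_ifs with h
  · rw [show 2 * n + 1 - s - (n + 1) = n - s by omega, Nat.choose_symm (by omega)]
    ring
  · rw [Nat.choose_eq_zero_of_lt (show n < s by omega)]
    simp

/-- The coefficients of the denominator of the `[n / n + 1]` Padé approximant of
`2 e ^ t / (e ^ t + 1)`. -/
def eulerPadeDen (n j : ℕ) : ℚ :=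
  (expPadeNum n j + expPadeDen n j) / 2

theorem eulerPadeDen_zero (n : ℕ) : eulerPadeDen n 0 = 1 := by
  have : ((2 * n + 1)! : ℚ) ≠ 0 := by positivity
  simp [eulerPadeDen, expPadeNum, expPadeDen, this]

theorem eulerPadeDen_succ_self (n : ℕ) :
    eulerPadeDen n (n + 1) = (-1) ^ (n + 1) * ((n + 1)! : ℚ) / ((2 * n + 2)! : ℚ) := by
  have h1 : ((2 * n + 1)! : ℚ) ≠ 0 := by positivity
  rw [eulerPadeDen, expPadeNum, expPadeDen, Nat.choose_succ_self, Nat.choose_self,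
    show 2 * n + 1 - (n + 1) = n by omega, Nat.factorial_succ (2 * n + 1), Nat.factorial_succ n]
  push_cast
  field_simp
  ring

theorem eulerPadeDen_eq_zero {n j : ℕ} (h : n + 1 < j) : eulerPadeDen n j = 0 := by
  simp [eulerPadeDen, expPadeNum, expPadeDen, Nat.choose_eq_zero_of_lt h,
    Nat.choose_eq_zero_of_lt (show n < j by omega)]

theorem coeff_eulerPadeDen_mul {f : PowerSeries ℚ}
    (hf : f * (PowerSeries.exp ℚ + 1) = 2 * PowerSeries.exp ℚ) {n s : ℕ} (h1 : n < s)
    (h2 : s ≤ 2 * n + 1) :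
    PowerSeries.coeff s (PowerSeries.mk (eulerPadeDen n) * f) = 0 := by
  set P := PowerSeries.mk (expPadeNum n)
  set D := PowerSeries.mk (expPadeDen n)
  set Q := PowerSeries.mk (eulerPadeDen n)
  set e := PowerSeries.exp ℚ
  have hQ : Q * 2 = P + D := by
    ext j
    rw [mul_comm, ← map_ofNat PowerSeries.C 2, PowerSeries.coeff_C_mul]
    simp only [Q, P, D, PowerSeries.coeff_mk, map_add, eulerPadeDen]
    ring
  have hu : (e + 1) * (e + 1)⁻¹ = 1 := PowerSeries.mul_inv_cancel _ (by simp [e])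
  have hR : PowerSeries.X ^ (2 * n + 2) ∣ D * e - P := by
    rw [PowerSeries.X_pow_dvd_iff]
    intro k hk
    rw [map_sub, coeff_mk_expPadeDen_mul_exp n k (by omega), PowerSeries.coeff_mk, sub_self]
  have hQf : Q * f - P = (D * e - P) * (e + 1)⁻¹ := by
    linear_combination (-(Q * f - P)) * hu + (e + 1)⁻¹ * Q * hf + e * (e + 1)⁻¹ * hQ
  have h := PowerSeries.X_pow_dvd_iff.mp (hQf ▸ hR.mul_right _ :
    PowerSeries.X ^ (2 * n + 2) ∣ Q * f - P) s (by omega)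
  rw [map_sub, PowerSeries.coeff_mk, expPadeNum, Nat.choose_eq_zero_of_lt h1] at h
  simpa using h

/-- If the first `n + 1` shifts of `c` satisfy a linear recurrence of order `n + 1` with constant
coefficient `a 0`, then shifting `c` multiplies the Hankel determinant by `(-1) ^ n * a 0`. -/
theorem hankelDet_shift {R : Type*} [CommRing R] (n : ℕ) (c a : ℕ → R)
    (h : ∀ i ≤ n, c (i + n + 1) = ∑ k ∈ Finset.range (n + 1), c (i + k) * a k) :
    hankelDet n (fun k => c (k + 1)) = (-1) ^ n * a 0 * hankelDet n c := by
  -- Companion matrix: right multiplication shifts the Hankel columns left and fills the last one by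
  -- the recurrence.
  let C : Matrix (Fin (n + 1)) (Fin (n + 1)) R := Matrix.of fun i j =>
    if j = Fin.last n then a i else if (i : ℕ) = j + 1 then 1 else 0
  have hC : C.det = (-1) ^ n * a 0 := by
    rw [Matrix.det_succ_row_zero, Finset.sum_eq_single (Fin.last n)]
    · have hsub : C.submatrix Fin.succ (Fin.last n).succAbove = 1 := by
        ext i j
        simp [C, Matrix.one_apply, Fin.ext_iff, j.2.ne]
      rw [hsub]
      simp [C]
    · intro j _ hj
      simp [C, hj]
    · simp
  have hmul : (Matrix.of fun i j : Fin (n + 1) => c ((i : ℕ) + (j : ℕ) + 1)) =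
      (Matrix.of fun i j : Fin (n + 1) => c ((i : ℕ) + (j : ℕ))) * C := by
    ext i j
    rw [Matrix.mul_apply]
    rcases eq_or_ne j (Fin.last n) with rfl | hj
    · simp only [Matrix.of_apply, C, if_true, Fin.val_last]
      rw [h i (Nat.lt_succ_iff.mp i.2), Finset.sum_range]
    · have hlt : (j : ℕ) < n := Fin.val_lt_last hj
      rw [Finset.sum_eq_single (⟨j + 1, by omega⟩ : Fin (n + 1))]
      · simp [C, hj, add_assoc]
      · intro b _ hb
        have : (b : ℕ) ≠ j + 1 := fun hb' => hb (Fin.ext hb')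
        simp [C, hj, this]
      · simp
  rw [hankelDet, hmul, Matrix.det_mul, hC, mul_comm, hankelDet]

theorem mk_eulerPolynomial_eval_one_mul :
    PowerSeries.mk (fun k => (eulerPolynomial k).eval 1 / (k ! : ℚ)) * (PowerSeries.exp ℚ + 1) =
      2 * PowerSeries.exp ℚ := by
  have hmk : PowerSeries.mk (fun k => (eulerPolynomial k).eval 1 / (k ! : ℚ)) =
      PowerSeries.map (Polynomial.evalRingHom (1 : ℚ)) eulerGenFun := by
    ext k
    have : (k ! : ℚ) ≠ 0 := by positivity
    rw [PowerSeries.coeff_mk, PowerSeries.coeff_map, eulerPolynomial, Polynomial.eval_smul,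
      smul_eq_mul, mul_div_cancel_left₀ _ this, Polynomial.coe_evalRingHom]
  have h := congrArg (PowerSeries.map (Polynomial.evalRingHom (1 : ℚ))) eulerGenFun_mul
  rw [map_mul, map_mul, map_add, map_one, map_ofNat, PowerSeries.map_exp] at h
  rw [hmk, h]
  congr 1
  ext k
  simp [PowerSeries.coeff_rescale, PowerSeries.coeff_exp]

theorem proposition3p6 (n : ℕ) (hn : 1 ≤ n) :
    hankelDet n (fun k => (eulerPolynomial k).eval 1 / (k ! : ℚ)) =
      ((2 * n + 2)! : ℚ) / ((n + 1)! : ℚ) *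
        hankelDet n (fun k => (eulerPolynomial (k + 1)).eval 1 / ((k + 1)! : ℚ)) := by
  set c : ℕ → ℚ := fun k => (eulerPolynomial k).eval 1 / (k ! : ℚ)
  have hrec : ∀ i ≤ n, c (i + n + 1) =
      ∑ k ∈ Finset.range (n + 1), c (i + k) * -eulerPadeDen n (n + 1 - k) := by
    intro i hi
    have h := coeff_eulerPadeDen_mul mk_eulerPolynomial_eval_one_mul
      (show n < i + (n + 1) by omega) (by omega)
    rw [mul_comm, PowerSeries.coeff_mul, Finset.Nat.sum_antidiagonal_eq_sum_range_succ_mk] at h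
    simp only [PowerSeries.coeff_mk] at h
    change ∑ x ∈ Finset.range (i + (n + 1 + 1)), c x * eulerPadeDen n (i + (n + 1) - x) = 0 at h
    -- The first `i` terms involve `Q` beyond degree `n+1`; the last has coefficient `Q(0) = 1`.
    rw [Finset.sum_range_add, Finset.sum_eq_zero, zero_add,
      Finset.sum_range_succ] at h
    · simp only [Nat.sub_self, eulerPadeDen_zero, mul_one, Nat.add_sub_add_left] at h
      simp only [mul_neg, Finset.sum_neg_distrib]
      linear_combination h
    · intro k hk
      rw [eulerPadeDen_eq_zero, mul_zero]
      have := Finset.mem_range.mp hk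
      omega
  have h := hankelDet_shift n c (fun k => -eulerPadeDen n (n + 1 - k)) hrec
  have h1 : ((n + 1)! : ℚ) ≠ 0 := by positivity
  have h2 : ((2 * n + 2)! : ℚ) ≠ 0 := by positivity
  have h3 : ((-1 : ℚ) ^ n) * (-1) ^ n = 1 := by rw [← mul_pow]; norm_num
  change _ = _ * hankelDet n (fun k => c (k + 1))
  rw [h, Nat.sub_zero, eulerPadeDen_succ_self, pow_succ]
  field_simp
  linear_combination (-hankelDet n c) * h3
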